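/- Let $F_B$ and $F_C$ be probability distributions of nonnegative random variables $B$ and $C$ with finite positive means (for instance $B$ phase-type and $C$ heavy-tailed; no further property is used). Let $\lambda>0$, $\delta=\lambda\,\mathbb E B$, $\theta=\lambda\,\mathbb E C$. For $\epsilon\in[0,1]$ consider the Cramér–Lundberg model with premium rate $1$ in which claims arrive according to a Poisson process $N_\epsilon$ of rate $\lambda$ and the claim sizes $U_{\epsilon,i}$ are i.i.d. with law $(1-\epsilon)F_B+\epsilon F_C$ and independent of $N_\epsilon$. Let $M_\epsilon=\sup_{t\ge 0}\bigl(\sum_{i=1}^{N_\epsilon(t)}U_{\epsilon,i}-t\bigr)\in[0,\infty]$ and let $\psi_\epsilon(u)=\mathbb P(M_\epsilon>u)$ be the ruin probability for the initial capital $u\ge 0$. Let $B^e$ and $C^e$ have the stationary excess distributions $\mathbb P(B^e\le x)=\frac1{\mathbb E B}\int_0^x\mathbb P(B>t)\,dt$ and $\mathbb P(C^e\le x)=\frac1{\mathbb E C}\int_0^x\mathbb P(C>t)\,dt$, $x\ge0$, let $M_0,M_0'$ be independent copies of the maximum for $\epsilon=0$, independent of $B^e$ and $C^e$, and for $\delta\neq1$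 define the corrected replace approximation $$\hat\psi_\epsilon(u)=\psi_0(u)+\frac{\epsilon\theta}{1-\delta}\bigl(\mathbb P(M_0+M_0'+C^e>u)-\mathbb P(M_0>u)\bigr)-\frac{\epsilon\delta}{1-\delta}\bigl(\mathbb P(M_0+M_0'+B^e>u)-\mathbb P(M_0>u)\bigr).$$ Then, for all $\epsilon\in[0,1]$ with $\epsilon<|1-\delta|/(\delta+\theta)$ and all $u\ge0$, $$|\psi_\epsilon(u)-\hat\psi_\epsilon(u)|\le\Bigl(\frac{\epsilon}{1-\delta}\Bigr)^2(\delta+\theta)^2\,\frac{1-\delta}{1-\delta-\epsilon(\delta+\theta)}.$$ Hence, if $\delta\ne1$, then $|\psi_\epsilon(u)-\hat\psi_\epsilon(u)|=O(\epsilon^2)$ as $\epsilon\downarrow0$, uniformly in $u\ge0$. -/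

import Mathlib

open MeasureTheory ProbabilityTheory Filter
open scoped Topology NNReal

noncomputable section

/-- Epoch of the `n`-th claim (counted from `0`), for the interarrival times `T 0, T 1, …`. -/
def arrivalTime {Ω : Type*} (T : ℕ → Ω → ℝ) (n : ℕ) (ω : Ω) : ℝ :=
  ∑ i ∈ Finset.range (n + 1), T i ω

/-- The claim counting process: the number `N(t)` of claims that arrive up to time `t`
(for exponential interarrival times this set is almost surely finite for all `t`). -/
def claimCount {Ω : Type*} (T : ℕ → Ω → ℝ) (t : ℝ≥0) (ω : Ω) : ℕ :=
  Set.ncard {n : ℕ | arrivalTime T n ω ≤ (t : ℝ)}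

/-- The risk reserve `R(t) = u + t - ∑_{i ≤ N(t)} U_i`, with initial capital `u`
and premium rate `1`. -/
def riskReserve {Ω : Type*} (T U : ℕ → Ω → ℝ) (u : ℝ) (t : ℝ≥0) (ω : Ω) : ℝ :=
  u + (t : ℝ) - ∑ i ∈ Finset.range (claimCount T t ω), U i ω

/-- The claim surplus `S(t) = u - R(t)`; it does not depend on `u`, which is taken to be `0`. -/
def claimSurplus {Ω : Type*} (T U : ℕ → Ω → ℝ) (t : ℝ≥0) (ω : Ω) : ℝ :=
  0 - riskReserve T U 0 t ω

/-- The maximum `M = sup_{0 ≤ t < ∞} S(t)`, with values in the extended reals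
(it is infinite when the claim surplus is unbounded). -/
def maxSurplus {Ω : Type*} (T U : ℕ → Ω → ℝ) (ω : Ω) : EReal :=
  ⨆ t : ℝ≥0, ((claimSurplus T U t ω : ℝ) : EReal)

/-- The classical Cramér–Lundberg model: claims arrive according to a Poisson process of rate
`rate` (i.i.d. exponential interarrival times `T`); the claim sizes `U` are i.i.d. with law `G`
and independent of the arrivals. -/
structure IsCramerLundberg {Ω : Type*} [MeasurableSpace Ω] (P : Measure Ω)
    (T U : ℕ → Ω → ℝ) (rate : ℝ) (G : Measure ℝ) : Prop where
  isProbabilityMeasure : IsProbabilityMeasure P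
  measurable_interarrival : ∀ n, Measurable (T n)
  measurable_claim : ∀ n, Measurable (U n)
  law_interarrival : ∀ n, P.map (T n) = expMeasure rate
  law_claim : ∀ n, P.map (U n) = G
  indep : iIndepFun (fun k : ℕ ⊕ ℕ => Sum.elim T U k) P

/-- The ruin probability `ψ(u) = P(M > u)`. -/
def ruinProb {Ω : Type*} [MeasurableSpace Ω] (P : Measure Ω) (T U : ℕ → Ω → ℝ) (u : ℝ) : ℝ :=
  P.real {ω | (u : EReal) < maxSurplus T U ω}

/-- The claim size law `(1 - ε) F_B + ε F_C`. -/
def mixtureLaw (ε : ℝ) (FB FC : Measure ℝ) : Measure ℝ :=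
  ENNReal.ofReal (1 - ε) • FB + ENNReal.ofReal ε • FC

/-- The stationary excess law of `F`, with distribution function
`(1 / μ_F) ∫_0^u (1 - F(t)) dt`. -/
def stationaryExcess (F : Measure ℝ) : Measure ℝ :=
  (volume.restrict (Set.Ici 0)).withDensity
    fun t => ENNReal.ofReal (F.real (Set.Ioi t) / ∫ x, x ∂F)

/-- `P(M₀ + M₁ + X > u)` for independent `M₀, M₁, X`, where `M₀` and `M₁` are distributed as the
maximum of the claim surplus and `X` has law `H`. -/
def tailTwoMaxAdd {Ω : Type*} [MeasurableSpace Ω] (P : Measure Ω) (T U : ℕ → Ω → ℝ)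
    (H : Measure ℝ) (u : ℝ) : ℝ :=
  (P.prod (P.prod H)).real
    {z : Ω × Ω × ℝ | (u : EReal) < maxSurplus T U z.1 + maxSurplus T U z.2.1 + (z.2.2 : EReal)}

/-- The average amount of claim per unit time, `λ E X` for a claim `X` with law `F`. -/
def load (rate : ℝ) (F : Measure ℝ) : ℝ := rate * ∫ x, x ∂F

/-- The corrected replace approximation, where `(P, T, U)` is the base model in which all claim
sizes have law `FB`. -/
def correctedReplace {Ω : Type*} [MeasurableSpace Ω] (P : Measure Ω) (T U : ℕ → Ω → ℝ)
    (rate : ℝ) (FB FC : Measure ℝ) (ε u : ℝ) : ℝ :=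
  ruinProb P T U u
    + ε * load rate FC / (1 - load rate FB) *
        (tailTwoMaxAdd P T U (stationaryExcess FC) u - ruinProb P T U u)
    - ε * load rate FB / (1 - load rate FB) *
        (tailTwoMaxAdd P T U (stationaryExcess FB) u - ruinProb P T U u)

end

/-!
The proof compares the laws on `ℝ` of the maxima `M₀` and `M_ε`, and works with measures and their
convolutions only.

Suppose first that the base load `δ` is less than `1`; the condition on `ε` makes the perturbed load
less than `1` as well. The claim surplus decreases between claims, so its maximum is the maximum of
the random walk with steps `U n - T n` (`maxSurplus_eq_walkMax`), which is almost surely finite by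
the strong law of large numbers. Its law `μ` is therefore stationary for Lindley's recursion
`m ↦ max 0 (m + U - T)` (`map_walkMax_eq`). Since `T` is exponential, the distribution function of
`μ` satisfies an integrated differential equation, which turns into the Pollaczek–Khinchine formula
in renewal form, `μ = (1 - load) • δ_0 + load • Fᵉ ∗ μ` with `Fᵉ` the stationary excess law
(`eq_dirac_add_conv_of_lindley`, `IsCramerLundberg.maxLaw_eq`). The measure `load • Fᵉ` is additive
in the claim law, so for the mixture it equals `(1 - ε) δ • Bᵉ + ε θ • Cᵉ`.

Convolving the renewal equation of each maximum with the law of the other one gives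
`(1 - δ) μ_ε = (1 - δ - ε (θ - δ)) μ₀ - ε δ • Bᵉ ∗ μ₀ ∗ μ_ε + ε θ • Cᵉ ∗ μ₀ ∗ μ_ε`
(`one_sub_mul_measureReal_eq`). Hence the error of the corrected replace approximation is
`κ ∗ (μ_ε - μ₀)` for a signed measure `κ` of total variation at most `ρ = ε (δ + θ) / (1 - δ) < 1`,
while the correction itself has tails at most `ρ`. So `μ_ε - μ₀` has tails at most `ρ / (1 - ρ)`,
and the error is at most `ρ ^ 2 / (1 - ρ)` (`abs_measureReal_sub_approx_le`).

If `δ > 1`, the condition on `ε` keeps the perturbed load above `1`, both maxima are almost surely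
infinite and the error is `0`.
-/

/-! ### The maximum of the claim surplus as the maximum of a random walk -/

/-- The all-time maximum `sup_n (x 0 + ⋯ + x (n - 1))` of the walk with steps `x`; the empty sum
makes it nonnegative. -/
noncomputable def walkMax (x : ℕ → ℝ) : EReal := ⨆ n : ℕ, ((∑ i ∈ Finset.range n, x i : ℝ) : EReal)

lemma walkMax_nonneg (x : ℕ → ℝ) : 0 ≤ walkMax x :=
  le_iSup_of_le (f := fun n : ℕ => ((∑ i ∈ Finset.range n, x i : ℝ) : EReal)) 0 (by simp)

lemma walkMax_ne_bot (x : ℕ → ℝ) : walkMax x ≠ ⊥ :=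
  ne_of_gt (lt_of_lt_of_le (by simp) (walkMax_nonneg x))

lemma measurable_walkMax : Measurable walkMax := by
  refine Measurable.iSup fun n => ?_
  exact measurable_coe_real_ereal.comp (by fun_prop)

/-- Lindley's recursion: the maximum of the walk is attained either before the first step or
after it. -/
lemma walkMax_eq_max (x : ℕ → ℝ) :
    walkMax x = max 0 ((x 0 : EReal) + walkMax fun n => x (n + 1)) := by
  apply le_antisymm
  · refine iSup_le fun n => ?_
    cases n with
    | zero => simp
    | succ n =>
      rw [Finset.sum_range_succ', add_comm, EReal.coe_add]
      refine le_max_of_le_right (add_le_add_right ?_ _)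
      exact le_iSup (fun n : ℕ => ((∑ i ∈ Finset.range n, x (i + 1) : ℝ) : EReal)) n
  · refine max_le (walkMax_nonneg x) ?_
    rw [add_comm, ← EReal.le_sub_iff_add_le (by simp) (by simp)]
    refine iSup_le fun n => ?_
    rw [EReal.le_sub_iff_add_le (by simp) (by simp), ← EReal.coe_add]
    refine le_iSup_of_le (f := fun n : ℕ => ((∑ i ∈ Finset.range n, x i : ℝ) : EReal)) (n + 1) ?_
    rw [Finset.sum_range_succ']

/-- Between two claims the surplus decreases, so that its supremum over all times is the maximum
of the random walk of the surplus at the claim epochs. -/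
lemma maxSurplus_eq_walkMax {Ω : Type*} (T U : ℕ → Ω → ℝ) (ω : Ω) (hT : ∀ n, 0 < T n ω) :
    maxSurplus T U ω = walkMax fun n => U n ω - T n ω := by
  have hmono : StrictMono fun n => arrivalTime T n ω := by
    refine strictMono_nat_of_lt_succ fun n => ?_
    simp only [arrivalTime]
    rw [Finset.sum_range_succ _ (n + 1)]
    linarith [hT (n + 1)]
  have hpos : ∀ n, 0 < arrivalTime T n ω := fun n =>
    Finset.sum_pos (fun i _ => hT i) ⟨0, by simp⟩
  apply le_antisymm
  · refine iSup_le fun t => ?_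
    simp only [claimSurplus, riskReserve]
    rcases h : claimCount T t ω with _ | k
    · refine le_trans ?_ (walkMax_nonneg _)
      have := t.2
      simp only [Finset.range_zero, Finset.sum_empty]
      exact_mod_cast (by simp : 0 - (0 + (t : ℝ) - 0) ≤ 0)
    · refine le_iSup_of_le
        (f := fun n : ℕ => ((∑ i ∈ Finset.range n, (U i ω - T i ω) : ℝ) : EReal)) (k + 1) ?_
      have hk : arrivalTime T k ω ≤ t := by
        by_contra! hlt
        have hsub : {n : ℕ | arrivalTime T n ω ≤ (t : ℝ)} ⊆ Set.Iio k := by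
          intro n hn
          by_contra! hkn
          have := hmono.monotone (not_lt.mp hkn)
          simp only [Set.mem_ofPred_eq] at hn
          linarith
        have := Set.ncard_le_ncard hsub (Set.finite_Iio k)
        have h2 : (Set.Iio k).ncard = k := by
          rw [← Finset.coe_Iio, Set.ncard_coe_finset, Nat.card_Iio]
        simp only [claimCount] at h
        omega
      rw [EReal.coe_le_coe_iff, Finset.sum_sub_distrib]
      simp only [arrivalTime] at hk
      linarith
  · refine iSup_le fun n => ?_
    cases n with
    | zero =>
      refine le_iSup_of_le (f := fun t : ℝ≥0 => ((claimSurplus T U t ω : ℝ) : EReal)) 0 ?_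
      have h : claimCount T 0 ω = 0 := by
        simp only [claimCount]
        convert! Set.ncard_empty ℕ
        ext n
        simpa using hpos n
      simp [claimSurplus, riskReserve, h]
    | succ k =>
      obtain ⟨t, ht⟩ : ∃ t : ℝ≥0, (t : ℝ) = arrivalTime T k ω :=
        ⟨Real.toNNReal _, Real.coe_toNNReal _ (hpos k).le⟩
      refine le_iSup_of_le (f := fun t : ℝ≥0 => ((claimSurplus T U t ω : ℝ) : EReal)) t ?_
      have h : claimCount T t ω = k + 1 := by
        have : {n : ℕ | arrivalTime T n ω ≤ arrivalTime T k ω} = Set.Iic k := by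
          ext n
          exact hmono.le_iff_le
        rw [claimCount, ht, this, ← Finset.coe_Iic, Set.ncard_coe_finset, Nat.card_Iic]
      rw [EReal.coe_le_coe_iff, Finset.sum_sub_distrib]
      simp only [claimSurplus, riskReserve, h, ht]
      simp only [arrivalTime]
      linarith

/-! ### Random walks with independent identically distributed steps -/

section RandomWalk

variable {Ω : Type*} [MeasurableSpace Ω] {P : Measure Ω} {X : ℕ → Ω → ℝ}

lemma indepFun_zero_shift (hX : ∀ n, Measurable (X n)) (h : iIndepFun X P) :
    IndepFun (X 0) (fun ω n => X (n + 1) ω) P := by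
  rw [IndepFun_iff_Indep]
  have key := indep_iSup_of_disjoint (m := fun i => MeasurableSpace.comap (X i) inferInstance)
    (fun i => (hX i).comap_le) h (S := {0}) (T := Set.Ioi 0) (by simp)
  refine indep_of_indep_of_le_left (indep_of_indep_of_le_right key ?_) (by simp)
  simp only [MeasurableSpace.pi, MeasurableSpace.comap_iSup, MeasurableSpace.comap_comp]
  exact iSup_le fun n => le_iSup₂_of_le (n + 1) (by simp) le_rfl

lemma map_shift_eq_map (hX : ∀ n, Measurable (X n)) (h : iIndepFun X P) {η : Measure ℝ}
    (hη : ∀ n, P.map (X n) = η) :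
    P.map (fun ω n => X (n + 1) ω) = P.map (fun ω n => X n ω) := by
  rw [(h.precomp (g := fun n : ℕ => n + 1)
      (add_left_injective 1)).map_fun_eq_infinitePi_map fun n => hX (n + 1),
    h.map_fun_eq_infinitePi_map hX]
  simp only [hη]

lemma measurable_walkMax_toReal : Measurable fun x => (walkMax x).toReal :=
  measurable_ereal_toReal.comp measurable_walkMax

/-- The law of a finite maximum of a random walk with step law `η` is stationary for Lindley's
recursion `m ↦ max 0 (m + x)`. -/
lemma map_walkMax_eq (hX : ∀ n, Measurable (X n)) (h : iIndepFun X P) {η : Measure ℝ}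
    (hη : ∀ n, P.map (X n) = η) (hfin : ∀ᵐ ω ∂P, walkMax (fun n => X n ω) ≠ ⊤) :
    P.map (fun ω => (walkMax fun n => X n ω).toReal) =
      (P.map (fun ω => (walkMax fun n => X n ω).toReal) ∗ η).map fun x => max 0 x := by
  have := h.isProbabilityMeasure
  have hXm : Measurable fun ω n => X n ω := by fun_prop
  have hXm' : Measurable fun ω n => X (n + 1) ω := by fun_prop
  have hM' : Measurable fun ω => (walkMax fun n => X (n + 1) ω).toReal :=
    measurable_walkMax_toReal.comp hXm'
  have hlaw : P.map (fun ω => (walkMax fun n => X (n + 1) ω).toReal) =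
      P.map (fun ω => (walkMax fun n => X n ω).toReal) := by
    have := congrArg (Measure.map fun x => (walkMax x).toReal) (map_shift_eq_map hX h hη)
    rwa [Measure.map_map measurable_walkMax_toReal hXm',
      Measure.map_map measurable_walkMax_toReal hXm] at this
  have hind : IndepFun (fun ω => (walkMax fun n => X (n + 1) ω).toReal) (X 0) P :=
    ((indepFun_zero_shift hX h).comp measurable_id measurable_walkMax_toReal).symm
  have hae : (fun ω => (walkMax fun n => X n ω).toReal) =ᵐ[P]
      fun ω => max 0 ((walkMax fun n => X (n + 1) ω).toReal + X 0 ω) := by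
    filter_upwards [hfin] with ω hω
    rw [walkMax_eq_max] at hω ⊢
    have hb := walkMax_ne_bot fun n => X (n + 1) ω
    have ht : walkMax (fun n => X (n + 1) ω) ≠ ⊤ := by
      intro ht
      simp [ht] at hω
    rw [← EReal.coe_toReal ht hb, ← EReal.coe_add, ← EReal.coe_zero,
      ← EReal.coe_strictMono.monotone.map_max, EReal.toReal_coe, EReal.toReal_coe, add_comm]
  conv_lhs => rw [Measure.map_congr hae]
  rw [Measure.conv, ← hlaw, ← hη 0, ← (indepFun_iff_map_prod_eq_prod_map_map
    hM'.aemeasurable (hX 0).aemeasurable).1 hind,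
    Measure.map_map measurable_add (hM'.prodMk (hX 0)),
    Measure.map_map (by fun_prop) (measurable_add.comp (hM'.prodMk (hX 0)))]
  rfl

lemma tendsto_sum_div (hX : ∀ n, Measurable (X n)) (h : iIndepFun X P) {η : Measure ℝ}
    (hη : ∀ n, P.map (X n) = η) (hint : Integrable (fun x => x) η) :
    ∀ᵐ ω ∂P, Tendsto (fun n : ℕ => (∑ i ∈ Finset.range n, X i ω) / n) atTop (𝓝 (∫ x, x ∂η)) := by
  have := strong_law_ae_real X
    (by rw [← hη 0] at hint; exact hint.comp_measurable (hX 0))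
    (fun i j hij => h.indepFun hij)
    (fun i => ⟨(hX i).aemeasurable, (hX 0).aemeasurable, by rw [hη, hη]⟩)
  rwa [← hη 0, integral_map (hX 0).aemeasurable (by fun_prop)]

lemma walkMax_ne_top_of_drift_neg (hX : ∀ n, Measurable (X n)) (h : iIndepFun X P)
    {η : Measure ℝ} (hη : ∀ n, P.map (X n) = η) (hint : Integrable (fun x => x) η)
    (hneg : ∫ x, x ∂η < 0) : ∀ᵐ ω ∂P, walkMax (fun n => X n ω) ≠ ⊤ := by
  filter_upwards [tendsto_sum_div hX h hη hint] with ω hω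
  have hev : ∀ᶠ n : ℕ in atTop, ∑ i ∈ Finset.range n, X i ω ≤ 0 := by
    filter_upwards [hω.eventually_lt_const hneg, eventually_gt_atTop 0] with n hn hn0
    have : (0 : ℝ) < n := by exact_mod_cast hn0
    rw [div_lt_iff₀ this] at hn
    linarith
  obtain ⟨N, hN⟩ := eventually_atTop.1 hev
  have hbdd : ∃ K : ℝ, ∀ n, ∑ i ∈ Finset.range n, X i ω ≤ K := by
    obtain ⟨K, hK⟩ := ((Finset.range N).image fun n => ∑ i ∈ Finset.range n, X i ω).bddAbove
    refine ⟨max K 0, fun n => ?_⟩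
    rcases lt_or_ge n N with hn | hn
    · exact le_max_of_le_left (hK (by
        simp only [Finset.coe_image, Finset.coe_range]
        exact ⟨n, hn, rfl⟩))
    · exact le_max_of_le_right (hN n hn)
  obtain ⟨K, hK⟩ := hbdd
  refine ne_of_lt (lt_of_le_of_lt (iSup_le fun n => ?_) (EReal.coe_lt_top K))
  exact EReal.coe_le_coe_iff.2 (hK n)

lemma walkMax_eq_top_of_drift_pos (hX : ∀ n, Measurable (X n)) (h : iIndepFun X P)
    {η : Measure ℝ} (hη : ∀ n, P.map (X n) = η) (hint : Integrable (fun x => x) η)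
    (hpos : 0 < ∫ x, x ∂η) : ∀ᵐ ω ∂P, walkMax (fun n => X n ω) = ⊤ := by
  filter_upwards [tendsto_sum_div hX h hη hint] with ω hω
  have ht : Tendsto (fun n : ℕ => ∑ i ∈ Finset.range n, X i ω) atTop atTop := by
    refine (hω.pos_mul_atTop hpos tendsto_natCast_atTop_atTop).congr' ?_
    filter_upwards [eventually_gt_atTop 0] with n hn
    have : (n : ℝ) ≠ 0 := by exact_mod_cast hn.ne'
    field_simp
  rw [EReal.eq_top_iff_forall_lt]
  intro y
  obtain ⟨n, hn⟩ := (ht.eventually_gt_atTop y).exists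
  exact lt_of_lt_of_le (EReal.coe_lt_coe_iff.2 hn)
    (le_iSup (fun n : ℕ => ((∑ i ∈ Finset.range n, X i ω : ℝ) : EReal)) n)

end RandomWalk

/-! ### The exponential distribution -/

section Exponential

lemma expMeasure_Iic {r : ℝ} (hr : 0 < r) (x : ℝ) :
    expMeasure r (Set.Iic x) = ENNReal.ofReal (if 0 ≤ x then 1 - Real.exp (-(r * x)) else 0) := by
  have := isProbabilityMeasure_expMeasure hr
  rw [← cdf_expMeasure_eq hr, ofReal_cdf]

lemma ae_pos_expMeasure {r : ℝ} (hr : 0 < r) : ∀ᵐ x ∂expMeasure r, 0 < x := by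
  rw [ae_iff]
  have : {a : ℝ | ¬ 0 < a} = Set.Iic 0 := by ext; simp
  rw [this, expMeasure_Iic hr]
  simp

lemma expMeasure_Ici {r : ℝ} (hr : 0 < r) (x : ℝ) :
    expMeasure r (Set.Ici x) = ENNReal.ofReal (Real.exp (-(r * max x 0))) := by
  have := isProbabilityMeasure_expMeasure hr
  have : NullSingletonClass (expMeasure r) := by
    rw [expMeasure, gammaMeasure]; infer_instance
  rw [measure_congr Ioi_ae_eq_Ici.symm, ← Set.compl_Iic, prob_compl_eq_one_sub measurableSet_Iic,
    expMeasure_Iic hr, ← ENNReal.ofReal_one, ← ENNReal.ofReal_sub _ (by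
      split_ifs with h
      · simpa using by positivity
      · rfl)]
  split_ifs with h
  · rw [max_eq_left h]; ring_nf
  · rw [max_eq_right (by linarith)]; simp

lemma lintegral_id_expMeasure {r : ℝ} (hr : 0 < r) :
    ∫⁻ x, ENNReal.ofReal x ∂expMeasure r = ENNReal.ofReal r⁻¹ := by
  have hnn : 0 ≤ᵐ[expMeasure r] fun x => x := (ae_pos_expMeasure hr).mono fun x hx => hx.le
  rw [lintegral_eq_lintegral_meas_le _ hnn (by fun_prop)]
  have hr' : -r < 0 := by linarith
  have h1 : ∀ t ∈ Set.Ioi (0 : ℝ),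
      expMeasure r {a : ℝ | t ≤ a} = ENNReal.ofReal (Real.exp (-r * t)) := fun t ht => by
    have := expMeasure_Ici hr t
    rw [max_eq_left (le_of_lt ht), ← neg_mul] at this
    exact this
  rw [setLIntegral_congr_fun measurableSet_Ioi h1, ← ofReal_integral_eq_lintegral_ofReal
    (integrableOn_exp_mul_Ioi hr' 0) (ae_of_all _ fun x => (Real.exp_pos _).le),
    integral_exp_mul_Ioi hr']
  simp

lemma integrable_id_expMeasure {r : ℝ} (hr : 0 < r) :
    Integrable (fun x => x) (expMeasure r) := by
  refine ⟨by fun_prop, ?_⟩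
  rw [hasFiniteIntegral_iff_ofReal ((ae_pos_expMeasure hr).mono fun x hx => hx.le),
    lintegral_id_expMeasure hr]
  exact ENNReal.ofReal_lt_top

lemma integral_id_expMeasure {r : ℝ} (hr : 0 < r) : ∫ x, x ∂expMeasure r = r⁻¹ := by
  rw [integral_eq_lintegral_of_nonneg_ae ((ae_pos_expMeasure hr).mono fun x hx => hx.le)
    (by fun_prop), lintegral_id_expMeasure hr, ENNReal.toReal_ofReal (by positivity)]

end Exponential

/-! ### The Pollaczek–Khinchine renewal equation -/

lemma conv_apply (μ ν : Measure ℝ) [SFinite ν] {s : Set ℝ} (hs : MeasurableSet s) :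
    (μ ∗ ν) s = ∫⁻ x, ν ((fun y => x + y) ⁻¹' s) ∂μ := by
  rw [Measure.conv, Measure.map_apply measurable_add hs, Measure.prod_apply (measurable_add hs)]
  rfl

lemma measurable_measure_Ioi (G : Measure ℝ) : Measurable fun t => G (Set.Ioi t) :=
  Antitone.measurable fun _ _ h => measure_mono (Set.Ioi_subset_Ioi h)

/-- The measure on `[0, ∞)` with density the tail of `G`: the stationary excess law without
its normalization, which makes it additive in `G`. -/
noncomputable def integratedTail (G : Measure ℝ) : Measure ℝ :=
  (volume.restrict (Set.Ici 0)).withDensity fun t => G (Set.Ioi t)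

instance sFinite_integratedTail (G : Measure ℝ) : SFinite (integratedTail G) := by
  unfold integratedTail; infer_instance

lemma integratedTail_univ {G : Measure ℝ} (hG : ∀ᵐ x ∂G, 0 ≤ x)
    (hint : Integrable (fun x => x) G) :
    integratedTail G Set.univ = ENNReal.ofReal (∫ x, x ∂G) := by
  rw [integratedTail, withDensity_apply _ .univ, Measure.restrict_univ,
    ofReal_integral_eq_lintegral_ofReal hint hG, lintegral_eq_lintegral_meas_lt _ hG (by fun_prop),
    restrict_Ioi_eq_restrict_Ici]
  rfl

/-- For an exponential time `T` of rate `r` and fixed `w`, the distribution function of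
`max 0 (w - T)` solves the differential equation `F' = r F` on `[0, w)`, here in integrated form. -/
lemma ofReal_exp_eq_add_lintegral {r w u : ℝ} (hr : 0 < r) (hw : 0 ≤ w) (hu : 0 ≤ u) :
    ENNReal.ofReal (Real.exp (-(r * max (w - u) 0))) =
      ENNReal.ofReal (Real.exp (-(r * max (w - 0) 0))) + ENNReal.ofReal r *
        ∫⁻ s in Set.Icc 0 u, (Set.Ioi s).indicator
          (fun w => ENNReal.ofReal (Real.exp (-(r * max (w - s) 0)))) w := by
  set v := min u w with hv
  have hv0 : 0 ≤ v := le_min hu hw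
  have h1 : ∫⁻ s in Set.Icc 0 u, (Set.Ioi s).indicator
      (fun w => ENNReal.ofReal (Real.exp (-(r * max (w - s) 0)))) w =
      ∫⁻ s in Set.Ico 0 v, ENNReal.ofReal (Real.exp (-(r * (w - s)))) := by
    rw [setLIntegral_congr Ico_ae_eq_Icc.symm, ← lintegral_indicator measurableSet_Ico,
      ← lintegral_indicator measurableSet_Ico]
    congr 1
    ext s
    by_cases hs : s < w
    · simp [Set.indicator, hs, hv, max_eq_left (sub_nonneg.2 hs.le)]
    · simp [Set.indicator, hs, hv]
  have hderiv : ∀ s ∈ Set.uIcc 0 v, HasDerivAt (fun s => Real.exp (-(r * (w - s))))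
      (r * Real.exp (-(r * (w - s)))) s := by
    intro s _
    have : HasDerivAt (fun s : ℝ => -(r * (w - s))) r s := by
      convert! (((hasDerivAt_id s).const_sub w).const_mul r).neg using 1
      ring
    convert! this.exp using 1
    ring
  have h2 : ENNReal.ofReal r * ∫⁻ s in Set.Ico 0 v, ENNReal.ofReal (Real.exp (-(r * (w - s)))) =
      ENNReal.ofReal (Real.exp (-(r * (w - v))) - Real.exp (-(r * w))) := by
    have hFTC := intervalIntegral.integral_eq_sub_of_hasDerivAt hderiv
      (Continuous.intervalIntegrable (by fun_prop) _ _)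
    rw [sub_zero] at hFTC
    rw [← hFTC, intervalIntegral.integral_of_le hv0, ← integral_Ico_eq_integral_Ioc,
      integral_const_mul, ENNReal.ofReal_mul hr.le, ofReal_integral_eq_lintegral_ofReal
        ((Continuous.integrableOn_Icc (by fun_prop)).mono_set Set.Ico_subset_Icc_self)
        (ae_of_all _ fun x => (Real.exp_pos _).le)]
  have h3 : max (w - u) 0 = w - v := by
    rw [hv]; rcases le_total u w with h | h <;> simp [h]
  rw [h1, h2, h3, sub_zero, max_eq_left hw, ← ENNReal.ofReal_add (Real.exp_pos _).le,
    add_sub_cancel]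
  rw [sub_nonneg, Real.exp_le_exp]
  nlinarith

section PollaczekKhinchine

variable {μ G : Measure ℝ} {r : ℝ}

lemma map_neg_expMeasure_preimage (hr : 0 < r) (w u : ℝ) :
    ((expMeasure r).map (fun x => -x)) ((fun y => w + y) ⁻¹' Set.Iic u) =
      ENNReal.ofReal (Real.exp (-(r * max (w - u) 0))) := by
  rw [Measure.map_apply measurable_neg (measurableSet_Iic.preimage (by fun_prop)),
    ← expMeasure_Ici hr]
  congr 1
  ext x
  simp only [Set.mem_preimage, Set.mem_Iic, Set.mem_Ici]
  constructor <;> intro h <;> linarith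

/-- Stationarity for Lindley's recursion `m ↦ max 0 (m + U - T)` with exponential `T`, as an
equation for the distribution function in which `T` is integrated out. -/
lemma measure_Iic_of_lindley [SFinite G] (hr : 0 < r)
    (hμ : μ = (μ ∗ (G ∗ (expMeasure r).map fun x => -x)).map fun x => max 0 x)
    {u : ℝ} (hu : 0 ≤ u) :
    μ (Set.Iic u) = ∫⁻ w, ENNReal.ofReal (Real.exp (-(r * max (w - u) 0))) ∂(μ ∗ G) := by
  have := isProbabilityMeasure_expMeasure hr
  have : IsProbabilityMeasure ((expMeasure r).map fun x => -x) :=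
    Measure.isProbabilityMeasure_map (by fun_prop)
  conv_lhs => rw [hμ]
  rw [Measure.map_apply (by fun_prop) measurableSet_Iic, ← Measure.conv_assoc]
  have hpre : (fun x : ℝ => max 0 x) ⁻¹' Set.Iic u = Set.Iic u := by ext x; simp [hu]
  rw [hpre, conv_apply _ _ measurableSet_Iic]
  simp_rw [map_neg_expMeasure_preimage hr]

/-- A nonnegative claim added to a maximum that is at most `s` overshoots `s` with a probability
governed by the claim tail. -/
lemma measure_Iic_eq_conv_add [IsProbabilityMeasure μ] [IsProbabilityMeasure G]
    (hG : ∀ᵐ x ∂G, 0 ≤ x) (s : ℝ) :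
    μ (Set.Iic s) = (μ ∗ G) (Set.Iic s) +
      ∫⁻ m, (Set.Iic s).indicator (fun m => G (Set.Ioi (s - m))) m ∂μ := by
  rw [conv_apply _ _ measurableSet_Iic, ← lintegral_add_right _
    (Measurable.indicator (f := fun m => G (Set.Ioi (s - m)))
      ((measurable_measure_Ioi G).comp (by fun_prop)) measurableSet_Iic),
    ← lintegral_indicator_one measurableSet_Iic]
  congr 1
  ext m
  have hpre : (fun y => m + y) ⁻¹' Set.Iic s = Set.Iic (s - m) := by
    ext; simp [le_sub_iff_add_le']
  rw [hpre]
  by_cases hm : m ≤ s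
  · simp only [Set.indicator, Set.mem_Iic, hm, if_true, Pi.one_apply]
    rw [← Set.compl_Iic, prob_add_prob_compl measurableSet_Iic]
  · simp only [Set.indicator, Set.mem_Iic, hm, if_false, add_zero]
    refine (measure_mono_null (fun x hx => ?_) (ae_iff.1 hG)).symm
    have : x ≤ s - m := hx
    simp only [Set.mem_ofPred_eq]
    linarith

lemma conv_integratedTail_Iic [SFinite μ] (hμ0 : ∀ᵐ x ∂μ, 0 ≤ x) (u : ℝ) :
    (integratedTail G ∗ μ) (Set.Iic u) = ∫⁻ s in Set.Icc 0 u,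
      ∫⁻ m, (Set.Iic s).indicator (fun m => G (Set.Ioi (s - m))) m ∂μ := by
  have hmeas : Measurable fun p : ℝ × ℝ =>
      (Set.Iic p.2).indicator (fun m => G (Set.Ioi (p.2 - m))) p.1 := by
    have : (fun p : ℝ × ℝ => (Set.Iic p.2).indicator (fun m => G (Set.Ioi (p.2 - m))) p.1) =
        {p : ℝ × ℝ | p.1 ≤ p.2}.indicator fun p => G (Set.Ioi (p.2 - p.1)) := by
      ext p; simp [Set.indicator]
    rw [this]
    exact ((measurable_measure_Ioi G).comp (by fun_prop)).indicator
      (measurableSet_le measurable_fst measurable_snd)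
  rw [Measure.conv_comm, conv_apply _ _ measurableSet_Iic, lintegral_lintegral_swap
    (f := fun s m => (Set.Iic s).indicator (fun m => G (Set.Ioi (s - m))) m)
    (hmeas.comp measurable_swap).aemeasurable]
  refine lintegral_congr_ae ?_
  filter_upwards [hμ0] with m hm
  have hpre : (fun y => m + y) ⁻¹' Set.Iic u = Set.Iic (u - m) := by
    ext; simp [le_sub_iff_add_le']
  rw [hpre, integratedTail, withDensity_apply _ measurableSet_Iic,
    Measure.restrict_restrict measurableSet_Iic, ← lintegral_indicator
      (measurableSet_Iic.inter measurableSet_Ici), ← lintegral_indicator measurableSet_Icc,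
    ← lintegral_sub_right_eq_self _ m]
  congr 1
  ext s
  by_cases hs : m ≤ s
  · have : 0 ≤ s := hm.trans hs
    simp [Set.indicator, hs, this]
  · simp [Set.indicator, hs]

/-- The Pollaczek–Khinchine formula as a renewal equation, up to the mass of the atom at `0`. -/
lemma eq_dirac_add_conv_of_lindley [IsProbabilityMeasure μ] [IsProbabilityMeasure G]
    (hr : 0 < r) (hG : ∀ᵐ x ∂G, 0 ≤ x)
    (hμ : μ = (μ ∗ (G ∗ (expMeasure r).map fun x => -x)).map fun x => max 0 x) :
    μ = μ (Set.Iic 0) • Measure.dirac 0 + (ENNReal.ofReal r • integratedTail G) ∗ μ := by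
  have hμ0 : ∀ᵐ x ∂μ, 0 ≤ x := by
    rw [hμ, ae_map_iff (by fun_prop) measurableSet_Ici]
    exact ae_of_all _ fun x => le_max_left _ _
  refine Measure.ext_of_Iic _ _ fun u => ?_
  rw [Measure.add_apply, Measure.smul_apply, Measure.conv_smul_left, Measure.smul_apply,
    conv_integratedTail_Iic hμ0, smul_eq_mul, smul_eq_mul]
  rcases lt_or_ge u 0 with hu | hu
  · have h1 : μ (Set.Iic u) = 0 := by
      refine measure_mono_null (fun x hx => ?_) (ae_iff.1 hμ0)
      have : x ≤ u := hx
      simp only [Set.mem_ofPred_eq]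
      linarith
    rw [h1, Set.Icc_eq_empty (by linarith)]
    simp [hu]
  have hν0 : ∀ᵐ w ∂(μ ∗ G), 0 ≤ w := by
    rw [Measure.conv, ae_map_iff (by fun_prop) measurableSet_Ici]
    filter_upwards [Measure.quasiMeasurePreserving_fst.ae hμ0,
      Measure.quasiMeasurePreserving_snd.ae hG] with p h1 h2 using add_nonneg h1 h2
  have hmeas : Measurable fun p : ℝ × ℝ => (Set.Ioi p.2).indicator
      (fun w => ENNReal.ofReal (Real.exp (-(r * max (w - p.2) 0)))) p.1 := by
    have : (fun p : ℝ × ℝ => (Set.Ioi p.2).indicator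
        (fun w => ENNReal.ofReal (Real.exp (-(r * max (w - p.2) 0)))) p.1) =
        {p : ℝ × ℝ | p.2 < p.1}.indicator
          fun p => ENNReal.ofReal (Real.exp (-(r * max (p.1 - p.2) 0))) := by
      ext p; simp [Set.indicator]
    rw [this]
    exact Measurable.indicator (by fun_prop) (measurableSet_lt measurable_snd measurable_fst)
  -- Both sides are `μ (Iic s) - (μ ∗ G) (Iic s)`: on the left because the integrand is `1` for
  -- `w ≤ s`, on the right because claims are nonnegative.
  have hinner : ∀ s, 0 ≤ s → ∫⁻ w, (Set.Ioi s).indicator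
      (fun w => ENNReal.ofReal (Real.exp (-(r * max (w - s) 0)))) w ∂(μ ∗ G) =
      ∫⁻ m, (Set.Iic s).indicator (fun m => G (Set.Ioi (s - m))) m ∂μ := by
    intro s hs
    have h1 := measure_Iic_of_lindley hr hμ hs
    rw [measure_Iic_eq_conv_add hG s,
      ← lintegral_add_compl (μ := μ ∗ G) _ (measurableSet_Iic (a := s)),
      setLIntegral_congr_fun (g := fun _ => 1) measurableSet_Iic (fun w hw => by
        have : w ≤ s := hw
        simp [max_eq_right (sub_nonpos.2 this)]), setLIntegral_one, Set.compl_Iic] at h1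
    rw [lintegral_indicator measurableSet_Ioi]
    exact ((ENNReal.add_right_inj (measure_ne_top _ _)).1 h1).symm
  rw [measure_Iic_of_lindley hr hμ hu, measure_Iic_of_lindley hr hμ le_rfl]
  rw [lintegral_congr_ae (hν0.mono fun w hw => ofReal_exp_eq_add_lintegral hr hw hu),
    lintegral_add_left (by fun_prop), lintegral_const_mul _ hmeas.lintegral_prod_right',
    lintegral_lintegral_swap hmeas.aemeasurable,
    setLIntegral_congr_fun measurableSet_Icc fun s hs => hinner s hs.1]
  simp [hu]

end PollaczekKhinchine

/-! ### Stationary excess laws and mixtures -/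

section StationaryExcess

variable {F : Measure ℝ}

lemma stationaryExcess_eq [IsFiniteMeasure F] (hpos : 0 < ∫ x, x ∂F) :
    stationaryExcess F = (ENNReal.ofReal (∫ x, x ∂F))⁻¹ • integratedTail F := by
  rw [stationaryExcess, integratedTail,
    ← withDensity_smul _ (measurable_measure_Ioi F)]
  congr 1
  ext t
  rw [ENNReal.ofReal_div_of_pos hpos, ofReal_measureReal, ENNReal.div_eq_inv_mul]
  rfl

lemma isProbabilityMeasure_stationaryExcess [IsFiniteMeasure F] (hF : ∀ᵐ x ∂F, 0 ≤ x)
    (hint : Integrable (fun x => x) F) (hpos : 0 < ∫ x, x ∂F) :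
    IsProbabilityMeasure (stationaryExcess F) := by
  constructor
  rw [stationaryExcess_eq hpos, Measure.smul_apply, integratedTail_univ hF hint, smul_eq_mul,
    ENNReal.inv_mul_cancel (by simpa using hpos) ENNReal.ofReal_ne_top]

lemma ofReal_smul_integratedTail [IsFiniteMeasure F] {r : ℝ} (hr : 0 < r)
    (hpos : 0 < ∫ x, x ∂F) :
    ENNReal.ofReal r • integratedTail F = ENNReal.ofReal (load r F) • stationaryExcess F := by
  rw [stationaryExcess_eq hpos, smul_smul, load, ENNReal.ofReal_mul hr.le, mul_assoc,
    ENNReal.mul_inv_cancel (by simpa using hpos) ENNReal.ofReal_ne_top, mul_one]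

end StationaryExcess

section Mixture

variable {FB FC : Measure ℝ} {ε : ℝ}

lemma integratedTail_mixtureLaw :
    integratedTail (mixtureLaw ε FB FC) =
      ENNReal.ofReal (1 - ε) • integratedTail FB + ENNReal.ofReal ε • integratedTail FC := by
  have hB := measurable_measure_Ioi FB
  have hC := measurable_measure_Ioi FC
  simp only [integratedTail]
  rw [← withDensity_smul _ hB, ← withDensity_smul _ hC, ← withDensity_add_left (hB.const_smul _)]
  rfl

lemma ae_nonneg_mixtureLaw (hB : ∀ᵐ x ∂FB, 0 ≤ x) (hC : ∀ᵐ x ∂FC, 0 ≤ x) :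
    ∀ᵐ x ∂mixtureLaw ε FB FC, 0 ≤ x := by
  rw [mixtureLaw, ae_add_measure_iff]
  exact ⟨Measure.ae_smul_measure hB _, Measure.ae_smul_measure hC _⟩

lemma integrable_mixtureLaw (hB : Integrable (fun x => x) FB) (hC : Integrable (fun x => x) FC) :
    Integrable (fun x => x) (mixtureLaw ε FB FC) :=
  (hB.smul_measure ENNReal.ofReal_ne_top).add_measure (hC.smul_measure ENNReal.ofReal_ne_top)

lemma load_mixtureLaw (hε : ε ∈ Set.Icc (0 : ℝ) 1) (hB : Integrable (fun x => x) FB)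
    (hC : Integrable (fun x => x) FC) (r : ℝ) :
    load r (mixtureLaw ε FB FC) = (1 - ε) * load r FB + ε * load r FC := by
  rw [load, mixtureLaw, integral_add_measure (hB.smul_measure ENNReal.ofReal_ne_top)
    (hC.smul_measure ENNReal.ofReal_ne_top), integral_smul_measure, integral_smul_measure,
    ENNReal.toReal_ofReal (sub_nonneg.2 hε.2), ENNReal.toReal_ofReal hε.1, load, load]
  simp only [smul_eq_mul]
  ring

lemma mixtureLaw_zero : mixtureLaw 0 FB FC = FB := by simp [mixtureLaw]

end Mixture

/-! ### The maximum in the Cramér–Lundberg model -/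

/-- The law of the maximum of the claim surplus as a measure on `ℝ`, obtained from the walk
embedded at the claim epochs. An infinite maximum is sent to `0`, so that this law is only
meaningful for load less than `1`. -/
noncomputable def maxLaw {Ω : Type*} [MeasurableSpace Ω] (P : Measure Ω) (T U : ℕ → Ω → ℝ) :
    Measure ℝ :=
  P.map fun ω => (walkMax fun n => U n ω - T n ω).toReal

namespace IsCramerLundberg

variable {Ω : Type*} [MeasurableSpace Ω] {P : Measure Ω} {T U : ℕ → Ω → ℝ} {r : ℝ} {G : Measure ℝ}

lemma measurable_step (h : IsCramerLundberg P T U r G) (n : ℕ) :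
    Measurable fun ω => U n ω - T n ω :=
  (h.measurable_claim n).sub (h.measurable_interarrival n)

lemma isProbabilityMeasure_law (h : IsCramerLundberg P T U r G) : IsProbabilityMeasure G := by
  have := h.isProbabilityMeasure
  rw [← h.law_claim 0]
  exact Measure.isProbabilityMeasure_map (h.measurable_claim 0).aemeasurable

/-- The steps of the embedded walk are independent: group the independent family of interarrival
times and claims into the pairs that belong to the same claim. -/
lemma iIndepFun_step (h : IsCramerLundberg P T U r G) :
    iIndepFun (fun n ω => U n ω - T n ω) P := by
  have := h.isProbabilityMeasure
  have hinj : Function.Injective fun p : ℕ × Bool => if p.2 then Sum.inl p.1 else Sum.inr p.1 := by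
    rintro ⟨m, _ | _⟩ ⟨n, _ | _⟩ hmn <;> simp_all
  have hm : ∀ n b, Measurable fun ω =>
      Sum.elim T U (if b = true then Sum.inl n else Sum.inr n : ℕ ⊕ ℕ) ω := by
    rintro n (_ | _)
    · exact h.measurable_claim n
    · exact h.measurable_interarrival n
  have hprob : ∀ n b, IsProbabilityMeasure (P.map fun ω =>
      Sum.elim T U (if b = true then Sum.inl n else Sum.inr n : ℕ ⊕ ℕ) ω) :=
    fun n b => Measure.isProbabilityMeasure_map (hm n b).aemeasurable
  have hflat := h.indep.precomp hinj
  have hpairs : iIndepFun (fun (n : ℕ) ω (b : Bool) =>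
      Sum.elim T U (if b = true then Sum.inl n else Sum.inr n : ℕ ⊕ ℕ) ω) P := by
    rw [iIndepFun_iff_map_fun_eq_infinitePi_map (by fun_prop)]
    have h1 := congrArg (Measure.map (MeasurableEquiv.curry ℕ Bool ℝ))
      (hflat.map_fun_eq_infinitePi_map fun p => hm p.1 p.2)
    rw [Measure.map_map (by fun_prop) (measurable_pi_lambda _ fun p : ℕ × Bool => hm p.1 p.2)]
      at h1
    have h2 := Measure.infinitePi_map_curry (fun (n : ℕ) (b : Bool) => P.map fun ω =>
      Sum.elim T U (if b = true then Sum.inl n else Sum.inr n : ℕ ⊕ ℕ) ω)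
    refine (h1.trans h2).trans ?_
    congr 1
    ext1 n
    exact ((hflat.precomp (g := fun b : Bool => (n, b)) (Prod.mk_right_injective n)
      ).map_fun_eq_infinitePi_map fun b => hm n b).symm
  exact hpairs.comp (fun _ y => y false - y true) fun _ => by fun_prop

lemma map_step (h : IsCramerLundberg P T U r G) (n : ℕ) :
    P.map (fun ω => U n ω - T n ω) = G ∗ (expMeasure r).map fun x => -x := by
  have := h.isProbabilityMeasure
  have hind : IndepFun (U n) (T n) P :=
    h.indep.indepFun (i := Sum.inr n) (j := Sum.inl n) (by simp)
  have hind' : IndepFun (U n) (fun ω => -T n ω) P := hind.comp measurable_id measurable_neg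
  have h1 := (indepFun_iff_map_prod_eq_prod_map_map (h.measurable_claim n).aemeasurable
    (h.measurable_interarrival n).neg.aemeasurable).1 hind'
  rw [Measure.conv, ← h.law_claim n, ← h.law_interarrival n,
    Measure.map_map measurable_neg (h.measurable_interarrival n)]
  refine Eq.trans ?_ (congrArg (Measure.map fun x : ℝ × ℝ => x.1 + x.2) h1)
  rw [Measure.map_map measurable_add
    ((h.measurable_claim n).prodMk (h.measurable_interarrival n).neg)]
  rfl

lemma integrable_and_integral_id_step (h : IsCramerLundberg P T U r G) (hr : 0 < r)
    (hG : Integrable (fun x => x) G) :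
    Integrable (fun x => x) (G ∗ (expMeasure r).map fun x => -x) ∧
      ∫ x, x ∂(G ∗ (expMeasure r).map fun x => -x) = ∫ x, x ∂G - r⁻¹ := by
  have hU : Integrable (U 0) P := by
    rw [← h.law_claim 0] at hG
    exact hG.comp_measurable (h.measurable_claim 0)
  have hT : Integrable (T 0) P := by
    have := integrable_id_expMeasure hr
    rw [← h.law_interarrival 0] at this
    exact this.comp_measurable (h.measurable_interarrival 0)
  rw [← h.map_step 0]
  constructor
  · rw [integrable_map_measure (by fun_prop) (h.measurable_step 0).aemeasurable]
    exact hU.sub hT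
  · rw [integral_map (h.measurable_step 0).aemeasurable (by fun_prop), integral_sub hU hT,
      ← integral_id_expMeasure hr, ← h.law_claim 0, ← h.law_interarrival 0,
      integral_map (h.measurable_claim 0).aemeasurable (by fun_prop),
      integral_map (h.measurable_interarrival 0).aemeasurable (by fun_prop)]

lemma ae_maxSurplus_eq (h : IsCramerLundberg P T U r G) (hr : 0 < r) :
    ∀ᵐ ω ∂P, maxSurplus T U ω = walkMax fun n => U n ω - T n ω := by
  have hT : ∀ᵐ ω ∂P, ∀ n, 0 < T n ω := by
    refine ae_all_iff.2 fun n => ?_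
    have := ae_pos_expMeasure hr
    rw [← h.law_interarrival n] at this
    exact ae_of_ae_map (h.measurable_interarrival n).aemeasurable this
  exact hT.mono fun ω hω => maxSurplus_eq_walkMax T U ω hω

lemma measurable_walkMax_step (h : IsCramerLundberg P T U r G) :
    Measurable fun ω => (walkMax fun n => U n ω - T n ω).toReal :=
  measurable_walkMax_toReal.comp (measurable_pi_lambda _ h.measurable_step)

lemma isProbabilityMeasure_maxLaw (h : IsCramerLundberg P T U r G) :
    IsProbabilityMeasure (maxLaw P T U) :=
  have := h.isProbabilityMeasure
  Measure.isProbabilityMeasure_map h.measurable_walkMax_step.aemeasurable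

section Subcritical

lemma ae_walkMax_ne_top (h : IsCramerLundberg P T U r G) (hr : 0 < r)
    (hG : Integrable (fun x => x) G) (hload : load r G < 1) :
    ∀ᵐ ω ∂P, walkMax (fun n => U n ω - T n ω) ≠ ⊤ := by
  obtain ⟨h1, h2⟩ := h.integrable_and_integral_id_step hr hG
  refine walkMax_ne_top_of_drift_neg h.measurable_step h.iIndepFun_step h.map_step h1 ?_
  rw [h2, sub_neg, ← one_div, lt_div_iff₀ hr, mul_comm]
  exact hload

lemma ae_maxSurplus_eq_coe (h : IsCramerLundberg P T U r G) (hr : 0 < r)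
    (hG : Integrable (fun x => x) G) (hload : load r G < 1) :
    ∀ᵐ ω ∂P, maxSurplus T U ω = ((walkMax fun n => U n ω - T n ω).toReal : EReal) := by
  filter_upwards [h.ae_maxSurplus_eq hr, h.ae_walkMax_ne_top hr hG hload] with ω h1 h2
  rw [h1, EReal.coe_toReal h2 (walkMax_ne_bot _)]

/-- The Pollaczek–Khinchine formula for the maximum of the claim surplus, as a renewal
equation. -/
lemma maxLaw_eq (h : IsCramerLundberg P T U r G) (hr : 0 < r) (hG0 : ∀ᵐ x ∂G, 0 ≤ x)
    (hG : Integrable (fun x => x) G) (hload : load r G < 1) :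
    maxLaw P T U = ENNReal.ofReal (1 - load r G) • Measure.dirac 0 +
      (ENNReal.ofReal r • integratedTail G) ∗ maxLaw P T U := by
  have := h.isProbabilityMeasure_law
  have := h.isProbabilityMeasure_maxLaw
  have : IsProbabilityMeasure (P.map fun ω => (walkMax fun n => U n ω - T n ω).toReal) := this
  have key := eq_dirac_add_conv_of_lindley hr hG0
    (map_walkMax_eq h.measurable_step h.iIndepFun_step h.map_step
      (h.ae_walkMax_ne_top hr hG hload))
  rw [← maxLaw] at key
  -- The atom at `0` is determined by the total mass.
  have hmass := congrArg (fun ν => ν Set.univ) key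
  have hnn : 0 ≤ load r G := mul_nonneg hr.le (integral_nonneg_of_ae hG0)
  have hconv : ((ENNReal.ofReal r • integratedTail G) ∗ maxLaw P T U) Set.univ =
      ENNReal.ofReal (load r G) := by
    rw [conv_apply _ _ .univ]
    simp [integratedTail_univ hG0 hG, load, ENNReal.ofReal_mul hr.le]
  simp only [Measure.add_apply, Measure.smul_apply, measure_univ, hconv, smul_eq_mul,
    mul_one] at hmass
  have hatom : maxLaw P T U (Set.Iic 0) = ENNReal.ofReal (1 - load r G) := by
    rw [ENNReal.ofReal_sub _ hnn, ENNReal.ofReal_one, hmass,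
      ENNReal.add_sub_cancel_right ENNReal.ofReal_ne_top]
  rwa [hatom] at key

lemma ruinProb_eq (h : IsCramerLundberg P T U r G) (hr : 0 < r)
    (hG : Integrable (fun x => x) G) (hload : load r G < 1) (u : ℝ) :
    ruinProb P T U u = (maxLaw P T U).real (Set.Ioi u) := by
  rw [ruinProb, maxLaw, map_measureReal_apply h.measurable_walkMax_step measurableSet_Ioi]
  refine measureReal_congr ?_
  filter_upwards [h.ae_maxSurplus_eq_coe hr hG hload] with ω hω
  refine propext ?_
  change (u : EReal) < maxSurplus T U ω ↔ u < _
  rw [hω, EReal.coe_lt_coe_iff]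

lemma tailTwoMaxAdd_eq (h : IsCramerLundberg P T U r G) (hr : 0 < r)
    (hG : Integrable (fun x => x) G) (hload : load r G < 1) (H : Measure ℝ)
    [IsProbabilityMeasure H] (u : ℝ) :
    tailTwoMaxAdd P T U H u = (maxLaw P T U ∗ (maxLaw P T U ∗ H)).real (Set.Ioi u) := by
  have := h.isProbabilityMeasure
  have := h.isProbabilityMeasure_maxLaw
  have hm := h.measurable_walkMax_step
  have hm₁ : Measurable fun z : Ω × ℝ => (walkMax fun n => U n z.1 - T n z.1).toReal + z.2 :=
    (hm.comp measurable_fst).add measurable_snd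
  have hm₂ : Measurable fun z : Ω × Ω × ℝ => (walkMax fun n => U n z.1 - T n z.1).toReal +
      ((walkMax fun n => U n z.2.1 - T n z.2.1).toReal + z.2.2) :=
    (hm.comp measurable_fst).add (hm₁.comp measurable_snd)
  have hprod : maxLaw P T U ∗ (maxLaw P T U ∗ H) = (P.prod (P.prod H)).map fun z =>
      (walkMax fun n => U n z.1 - T n z.1).toReal +
        ((walkMax fun n => U n z.2.1 - T n z.2.1).toReal + z.2.2) := by
    have h1 : maxLaw P T U ∗ H =
        (P.prod H).map fun z => (walkMax fun n => U n z.1 - T n z.1).toReal + z.2 := by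
      conv_lhs => rw [Measure.conv, maxLaw, ← Measure.map_id (μ := H),
        Measure.map_prod_map _ _ hm measurable_id, Measure.map_map (by fun_prop) (by fun_prop)]
      rfl
    rw [h1, Measure.conv, maxLaw, Measure.map_prod_map _ _ hm hm₁,
      Measure.map_map measurable_add (hm.prodMap hm₁)]
    rfl
  rw [hprod, map_measureReal_apply hm₂ measurableSet_Ioi, tailTwoMaxAdd]
  refine measureReal_congr ?_
  have hae := h.ae_maxSurplus_eq_coe hr hG hload
  filter_upwards [Measure.quasiMeasurePreserving_fst.ae hae,
    (Measure.quasiMeasurePreserving_fst.comp Measure.quasiMeasurePreserving_snd).ae hae]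
    with z h1 h2
  refine propext ?_
  change (u : EReal) < maxSurplus T U z.1 + maxSurplus T U z.2.1 + (z.2.2 : EReal) ↔ u < _
  simp only [Function.comp_apply] at h2
  rw [h1, h2, ← EReal.coe_add, ← EReal.coe_add, EReal.coe_lt_coe_iff, add_assoc]

end Subcritical

section Supercritical

lemma ae_maxSurplus_eq_top (h : IsCramerLundberg P T U r G) (hr : 0 < r)
    (hG : Integrable (fun x => x) G) (hload : 1 < load r G) :
    ∀ᵐ ω ∂P, maxSurplus T U ω = ⊤ := by
  obtain ⟨h1, h2⟩ := h.integrable_and_integral_id_step hr hG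
  filter_upwards [h.ae_maxSurplus_eq hr, walkMax_eq_top_of_drift_pos h.measurable_step
    h.iIndepFun_step h.map_step h1 (by
      rw [h2, sub_pos, ← one_div, div_lt_iff₀ hr, mul_comm]
      exact hload)] with ω h3 h4
  rw [h3, h4]

lemma ruinProb_eq_one (h : IsCramerLundberg P T U r G) (hr : 0 < r)
    (hG : Integrable (fun x => x) G) (hload : 1 < load r G) (u : ℝ) :
    ruinProb P T U u = 1 := by
  have := h.isProbabilityMeasure
  rw [ruinProb, ← probReal_univ (μ := P)]
  refine measureReal_congr (eventuallyEq_univ.2 ?_)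
  filter_upwards [h.ae_maxSurplus_eq_top hr hG hload] with ω hω
  simp [hω]

lemma tailTwoMaxAdd_eq_one (h : IsCramerLundberg P T U r G) (hr : 0 < r)
    (hG : Integrable (fun x => x) G) (hload : 1 < load r G) (H : Measure ℝ)
    [IsProbabilityMeasure H] (u : ℝ) : tailTwoMaxAdd P T U H u = 1 := by
  have := h.isProbabilityMeasure
  have hae := h.ae_maxSurplus_eq_top hr hG hload
  rw [tailTwoMaxAdd, ← probReal_univ (μ := P.prod (P.prod H))]
  refine measureReal_congr (eventuallyEq_univ.2 ?_)
  filter_upwards [Measure.quasiMeasurePreserving_fst.ae hae,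
    (Measure.quasiMeasurePreserving_fst.comp Measure.quasiMeasurePreserving_snd).ae hae]
    with z h1 h2
  simp only [Function.comp_apply] at h2
  simp [h1, h2]

end Supercritical

end IsCramerLundberg

/-! ### Perturbation of the renewal equation -/

section Perturbation

variable {μ₀ μ₁ EB EC : Measure ℝ} [IsProbabilityMeasure μ₀] [IsProbabilityMeasure μ₁]
  [IsProbabilityMeasure EB] [IsProbabilityMeasure EC]

lemma measureReal_conv_sub (ν : Measure ℝ) [IsProbabilityMeasure ν] (u : ℝ) :
    (ν ∗ μ₁).real (Set.Ioi u) - (ν ∗ μ₀).real (Set.Ioi u) =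
      ∫ x, (μ₁.real (Set.Ioi (u - x)) - μ₀.real (Set.Ioi (u - x))) ∂ν := by
  have hint : ∀ (μ : Measure ℝ) [IsProbabilityMeasure μ],
      Integrable (fun x => μ.real (Set.Ioi (u - x))) ν := by
    intro μ _
    refine Integrable.of_bound (C := 1) ?_ (ae_of_all _ fun x => ?_)
    · exact ((measurable_measure_Ioi μ).ennreal_toReal.comp (by fun_prop)).aestronglyMeasurable
    · rw [Real.norm_of_nonneg measureReal_nonneg]
      exact measureReal_le_one
  have hconv : ∀ (μ : Measure ℝ) [IsProbabilityMeasure μ],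
      (ν ∗ μ).real (Set.Ioi u) = ∫ x, μ.real (Set.Ioi (u - x)) ∂ν := by
    intro μ _
    have hpre : ∀ x, (fun y => x + y) ⁻¹' Set.Ioi u = Set.Ioi (u - x) := fun x => by
      ext; simp [sub_lt_iff_lt_add']
    rw [Measure.real, conv_apply _ _ measurableSet_Ioi, ← integral_toReal]
    · simp only [hpre, Measure.real]
    · simp only [hpre]
      exact ((measurable_measure_Ioi μ).comp (by fun_prop)).aemeasurable
    · exact ae_of_all _ fun x => measure_lt_top _ _
  rw [hconv, hconv, integral_sub (hint _) (hint _)]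

lemma abs_measureReal_conv_sub_le (ν : Measure ℝ) [IsProbabilityMeasure ν] {c : ℝ}
    (hc : ∀ u, |μ₁.real (Set.Ioi u) - μ₀.real (Set.Ioi u)| ≤ c) (u : ℝ) :
    |(ν ∗ μ₁).real (Set.Ioi u) - (ν ∗ μ₀).real (Set.Ioi u)| ≤ c := by
  rw [measureReal_conv_sub]
  have := norm_integral_le_of_norm_le_const (μ := ν)
    (f := fun x => μ₁.real (Set.Ioi (u - x)) - μ₀.real (Set.Ioi (u - x)))
    (ae_of_all _ fun x => hc (u - x))
  simpa using this

lemma abs_measureReal_sub_le_one (μ ν : Measure ℝ) [IsProbabilityMeasure μ]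
    [IsProbabilityMeasure ν] (s : Set ℝ) : |μ.real s - ν.real s| ≤ 1 := by
  have h1 := measureReal_nonneg (μ := μ) (s := s)
  have h2 := measureReal_nonneg (μ := ν) (s := s)
  have h3 : μ.real s ≤ 1 := measureReal_le_one
  have h4 : ν.real s ≤ 1 := measureReal_le_one
  rw [abs_le]
  constructor <;> linarith

/-- Convolving each of the two renewal equations with the solution of the other one eliminates
the term `μ₀ ∗ μ₁` and the leading part of `EB ∗ μ₀ ∗ μ₁`. -/
lemma one_sub_mul_measureReal_eq {δ θ ε : ℝ} (hδ0 : 0 ≤ δ) (hθ0 : 0 ≤ θ) (hδ : δ ≤ 1)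
    (hε : ε ∈ Set.Icc (0 : ℝ) 1) (hδε : (1 - ε) * δ + ε * θ ≤ 1)
    (h₀ : μ₀ = ENNReal.ofReal (1 - δ) • Measure.dirac 0 + (ENNReal.ofReal δ • EB) ∗ μ₀)
    (h₁ : μ₁ = ENNReal.ofReal (1 - ((1 - ε) * δ + ε * θ)) • Measure.dirac 0 +
      (ENNReal.ofReal ((1 - ε) * δ) • EB + ENNReal.ofReal (ε * θ) • EC) ∗ μ₁) (s : Set ℝ) :
    (1 - δ) * μ₁.real s = (1 - ((1 - ε) * δ + ε * θ)) * μ₀.real s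
      - ε * δ * ((EB ∗ μ₀) ∗ μ₁).real s + ε * θ * ((EC ∗ μ₀) ∗ μ₁).real s := by
  have hε1 := sub_nonneg.2 hε.2
  have hfin : ∀ (c : ℝ) (ν : Measure ℝ) [IsFiniteMeasure ν], (ENNReal.ofReal c • ν) s ≠ ⊤ :=
    fun c ν _ => ENNReal.mul_ne_top ENNReal.ofReal_ne_top (measure_ne_top ν s)
  have e₀ : (μ₀ ∗ μ₁).real s = (1 - δ) * μ₁.real s + δ * ((EB ∗ μ₀) ∗ μ₁).real s := by
    have : μ₀ ∗ μ₁ = ENNReal.ofReal (1 - δ) • μ₁ + ENNReal.ofReal δ • ((EB ∗ μ₀) ∗ μ₁) := by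
      conv_lhs => rw [h₀]
      rw [Measure.conv_smul_left, Measure.add_conv, Measure.conv_smul_left,
        Measure.dirac_zero_conv, Measure.conv_smul_left]
    rw [this, measureReal_add_apply (hfin _ _) (hfin _ _), measureReal_ennreal_smul_apply,
      measureReal_ennreal_smul_apply, ENNReal.toReal_ofReal (sub_nonneg.2 hδ),
      ENNReal.toReal_ofReal hδ0]
  have hcomm : ∀ (E : Measure ℝ) [IsProbabilityMeasure E],
      (E ∗ μ₁) ∗ μ₀ = (E ∗ μ₀) ∗ μ₁ := fun E _ => by
    rw [Measure.conv_assoc, Measure.conv_comm μ₁ μ₀, ← Measure.conv_assoc]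
  have e₁ : (μ₀ ∗ μ₁).real s = (1 - ((1 - ε) * δ + ε * θ)) * μ₀.real s +
      ((1 - ε) * δ * ((EB ∗ μ₀) ∗ μ₁).real s + ε * θ * ((EC ∗ μ₀) ∗ μ₁).real s) := by
    have : μ₀ ∗ μ₁ = ENNReal.ofReal (1 - ((1 - ε) * δ + ε * θ)) • μ₀ +
        (ENNReal.ofReal ((1 - ε) * δ) • ((EB ∗ μ₀) ∗ μ₁) +
          ENNReal.ofReal (ε * θ) • ((EC ∗ μ₀) ∗ μ₁)) := by
      rw [Measure.conv_comm]
      conv_lhs => rw [h₁]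
      rw [Measure.add_conv, Measure.conv_smul_left, Measure.dirac_zero_conv,
        Measure.add_conv, Measure.add_conv, Measure.conv_smul_left, Measure.conv_smul_left,
        Measure.conv_smul_left, Measure.conv_smul_left, hcomm, hcomm]
    rw [this, measureReal_add_apply (hfin _ _)
        (ENNReal.add_ne_top.2 ⟨hfin _ _, hfin _ _⟩), measureReal_add_apply (hfin _ _) (hfin _ _),
      measureReal_ennreal_smul_apply, measureReal_ennreal_smul_apply,
      measureReal_ennreal_smul_apply,
      ENNReal.toReal_ofReal (sub_nonneg.2 hδε), ENNReal.toReal_ofReal (by positivity),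
      ENNReal.toReal_ofReal (mul_nonneg hε.1 hθ0)]
  linarith

/-- With `D = μ₁ - μ₀` and the signed measure `κ = ε / (1 - δ) • (θ • EC - δ • EB) ∗ μ₀`, whose
total variation is at most `ρ = ε (δ + θ) / (1 - δ)`, `one_sub_mul_measureReal_eq` says that the
error of the first order approximation is `κ ∗ D`, while the first order term itself has tails at
most `ρ`. So the tails of `D` are at most `ρ / (1 - ρ)`, and those of the error at most
`ρ ^ 2 / (1 - ρ)`. -/
theorem abs_measureReal_sub_approx_le {δ θ ε : ℝ} (hδ0 : 0 ≤ δ) (hθ0 : 0 ≤ θ) (hδ : δ < 1)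
    (hε : ε ∈ Set.Icc (0 : ℝ) 1) (hsmall : ε * (δ + θ) < 1 - δ)
    (h₀ : μ₀ = ENNReal.ofReal (1 - δ) • Measure.dirac 0 + (ENNReal.ofReal δ • EB) ∗ μ₀)
    (h₁ : μ₁ = ENNReal.ofReal (1 - ((1 - ε) * δ + ε * θ)) • Measure.dirac 0 +
      (ENNReal.ofReal ((1 - ε) * δ) • EB + ENNReal.ofReal (ε * θ) • EC) ∗ μ₁) (u : ℝ) :
    |μ₁.real (Set.Ioi u) - (μ₀.real (Set.Ioi u)
        + ε * θ / (1 - δ) * (((EC ∗ μ₀) ∗ μ₀).real (Set.Ioi u) - μ₀.real (Set.Ioi u))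
        - ε * δ / (1 - δ) * (((EB ∗ μ₀) ∗ μ₀).real (Set.Ioi u) - μ₀.real (Set.Ioi u)))|
      ≤ (ε / (1 - δ)) ^ 2 * (δ + θ) ^ 2 * ((1 - δ) / (1 - δ - ε * (δ + θ))) := by
  have hδ' : 0 < 1 - δ := sub_pos.2 hδ
  have hε0 := hε.1
  set ρ := ε * (δ + θ) / (1 - δ) with hρ
  have hρ0 : 0 ≤ ρ := by positivity
  have hρ1 : ρ < 1 := by rwa [hρ, div_lt_one hδ']
  have hδε : (1 - ε) * δ + ε * θ ≤ 1 := by nlinarith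
  have key := one_sub_mul_measureReal_eq hδ0 hθ0 hδ.le hε hδε h₀ h₁
  have hlin : ∀ a b c : ℝ, |a| ≤ c → |b| ≤ c →
      |ε * θ / (1 - δ) * a - ε * δ / (1 - δ) * b| ≤ ρ * c := by
    intro a b c ha hb
    have h1 : |ε * θ / (1 - δ) * a| ≤ ε * θ / (1 - δ) * c := by
      rw [abs_mul, abs_of_nonneg (by positivity : 0 ≤ ε * θ / (1 - δ))]
      gcongr
    have h2 : |ε * δ / (1 - δ) * b| ≤ ε * δ / (1 - δ) * c := by
      rw [abs_mul, abs_of_nonneg (by positivity : 0 ≤ ε * δ / (1 - δ))]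
      gcongr
    refine (abs_sub _ _).trans ((add_le_add h1 h2).trans (le_of_eq ?_))
    rw [hρ]
    ring
  have herr : ∀ u, μ₁.real (Set.Ioi u) - (μ₀.real (Set.Ioi u)
        + ε * θ / (1 - δ) * (((EC ∗ μ₀) ∗ μ₀).real (Set.Ioi u) - μ₀.real (Set.Ioi u))
        - ε * δ / (1 - δ) * (((EB ∗ μ₀) ∗ μ₀).real (Set.Ioi u) - μ₀.real (Set.Ioi u))) =
      ε * θ / (1 - δ) *
          (((EC ∗ μ₀) ∗ μ₁).real (Set.Ioi u) - ((EC ∗ μ₀) ∗ μ₀).real (Set.Ioi u))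
        - ε * δ / (1 - δ) *
          (((EB ∗ μ₀) ∗ μ₁).real (Set.Ioi u) - ((EB ∗ μ₀) ∗ μ₀).real (Set.Ioi u)) := by
    intro u
    field_simp
    linarith [key (Set.Ioi u)]
  set d : ℝ → ℝ := fun u => |μ₁.real (Set.Ioi u) - μ₀.real (Set.Ioi u)| with hd
  have hbdd : BddAbove (Set.range d) :=
    ⟨1, Set.forall_mem_range.2 fun u => abs_measureReal_sub_le_one _ _ _⟩
  have hle : ∀ u, d u ≤ ⨆ v, d v := fun u => le_ciSup hbdd u
  have hsecond : ∀ u, |μ₁.real (Set.Ioi u) - (μ₀.real (Set.Ioi u)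
        + ε * θ / (1 - δ) * (((EC ∗ μ₀) ∗ μ₀).real (Set.Ioi u) - μ₀.real (Set.Ioi u))
        - ε * δ / (1 - δ) * (((EB ∗ μ₀) ∗ μ₀).real (Set.Ioi u) - μ₀.real (Set.Ioi u)))|
      ≤ ρ * ⨆ v, d v := fun u => by
    rw [herr]
    exact hlin _ _ _ (abs_measureReal_conv_sub_le _ hle u) (abs_measureReal_conv_sub_le _ hle u)
  have hsup : (⨆ v, d v) ≤ ρ * (⨆ v, d v) + ρ * 1 := by
    refine ciSup_le fun u => ?_
    refine le_trans (le_of_eq ?_) ((abs_add_le _ _).trans (add_le_add (hsecond u)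
      (hlin _ _ 1 (abs_measureReal_sub_le_one ((EC ∗ μ₀) ∗ μ₀) μ₀ (Set.Ioi u))
        (abs_measureReal_sub_le_one ((EB ∗ μ₀) ∗ μ₀) μ₀ (Set.Ioi u)))))
    simp only [hd]
    congr 1
    ring
  have hsup' : (⨆ v, d v) ≤ ρ / (1 - ρ) := by
    rw [le_div_iff₀ (by linarith)]
    linarith
  refine (hsecond u).trans ((mul_le_mul_of_nonneg_left hsup' hρ0).trans (le_of_eq ?_))
  have h1 : 1 - δ - ε * (δ + θ) ≠ 0 := by linarith
  have h2 : 1 - ρ = (1 - δ - ε * (δ + θ)) / (1 - δ) := by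
    rw [hρ]; field_simp
  rw [h2, hρ]
  field_simp

end Perturbation

/-! ### The corrected replace approximation -/

section CorrectedReplace

variable {Ω : Type*} [MeasurableSpace Ω] {P₀ P₁ : Measure Ω} {T₀ U₀ T₁ U₁ : ℕ → Ω → ℝ}
  {r ε : ℝ} {FB FC : Measure ℝ} [IsProbabilityMeasure FB] [IsProbabilityMeasure FC]

lemma abs_ruinProb_sub_correctedReplace_le_of_load_lt_one (hr : 0 < r)
    (hB0 : ∀ᵐ x ∂FB, 0 ≤ x) (hC0 : ∀ᵐ x ∂FC, 0 ≤ x)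
    (hB : Integrable (fun x => x) FB) (hC : Integrable (fun x => x) FC)
    (hBpos : 0 < ∫ x, x ∂FB) (hCpos : 0 < ∫ x, x ∂FC)
    (h₀ : IsCramerLundberg P₀ T₀ U₀ r FB)
    (h₁ : IsCramerLundberg P₁ T₁ U₁ r (mixtureLaw ε FB FC)) (hε : ε ∈ Set.Icc (0 : ℝ) 1)
    (hload : load r FB < 1) (hsmall : ε * (load r FB + load r FC) < 1 - load r FB) (u : ℝ) :
    |ruinProb P₁ T₁ U₁ u - correctedReplace P₀ T₀ U₀ r FB FC ε u|
      ≤ (ε / (1 - load r FB)) ^ 2 * (load r FB + load r FC) ^ 2 *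
        ((1 - load r FB) / (1 - load r FB - ε * (load r FB + load r FC))) := by
  have hδ0 : 0 ≤ load r FB := (mul_pos hr hBpos).le
  have hθ0 : 0 ≤ load r FC := (mul_pos hr hCpos).le
  have hloadε := load_mixtureLaw hε hB hC r
  have hlt : load r (mixtureLaw ε FB FC) < 1 := by
    rw [hloadε]
    nlinarith [mul_nonneg hε.1 hδ0]
  have hint := integrable_mixtureLaw (ε := ε) hB hC
  have := isProbabilityMeasure_stationaryExcess hB0 hB hBpos
  have := isProbabilityMeasure_stationaryExcess hC0 hC hCpos
  have := h₀.isProbabilityMeasure_maxLaw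
  have := h₁.isProbabilityMeasure_maxLaw
  have e₀ := h₀.maxLaw_eq hr hB0 hB hload
  rw [ofReal_smul_integratedTail hr hBpos] at e₀
  have e₁ := h₁.maxLaw_eq hr (ae_nonneg_mixtureLaw hB0 hC0) hint hlt
  rw [hloadε, integratedTail_mixtureLaw, smul_add, smul_comm, smul_comm (ENNReal.ofReal r),
    ofReal_smul_integratedTail hr hBpos, ofReal_smul_integratedTail hr hCpos, smul_smul, smul_smul,
    ← ENNReal.ofReal_mul (sub_nonneg.2 hε.2), ← ENNReal.ofReal_mul hε.1] at e₁
  have hcomm : ∀ (H : Measure ℝ) [IsProbabilityMeasure H],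
      maxLaw P₀ T₀ U₀ ∗ (maxLaw P₀ T₀ U₀ ∗ H) = (H ∗ maxLaw P₀ T₀ U₀) ∗ maxLaw P₀ T₀ U₀ :=
    fun H _ => by rw [Measure.conv_comm, Measure.conv_comm _ H]
  rw [correctedReplace, h₁.ruinProb_eq hr hint hlt, h₀.ruinProb_eq hr hB hload,
    h₀.tailTwoMaxAdd_eq hr hB hload, h₀.tailTwoMaxAdd_eq hr hB hload, hcomm, hcomm]
  exact abs_measureReal_sub_approx_le hδ0 hθ0 hload hε hsmall e₀ e₁ u

/-- With load greater than `1` in the base model, ruin is certain in both models and in the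
approximation as well. -/
lemma ruinProb_sub_correctedReplace_of_one_lt_load (hr : 0 < r)
    (hB0 : ∀ᵐ x ∂FB, 0 ≤ x) (hC0 : ∀ᵐ x ∂FC, 0 ≤ x)
    (hB : Integrable (fun x => x) FB) (hC : Integrable (fun x => x) FC)
    (hBpos : 0 < ∫ x, x ∂FB) (hCpos : 0 < ∫ x, x ∂FC)
    (h₀ : IsCramerLundberg P₀ T₀ U₀ r FB)
    (h₁ : IsCramerLundberg P₁ T₁ U₁ r (mixtureLaw ε FB FC)) (hε : ε ∈ Set.Icc (0 : ℝ) 1)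
    (hload : 1 < load r FB) (hsmall : ε * (load r FB + load r FC) < load r FB - 1) (u : ℝ) :
    ruinProb P₁ T₁ U₁ u - correctedReplace P₀ T₀ U₀ r FB FC ε u = 0 := by
  have hlt : 1 < load r (mixtureLaw ε FB FC) := by
    rw [load_mixtureLaw hε hB hC]
    nlinarith [mul_nonneg hε.1 (mul_pos hr hCpos).le, show load r FC = r * ∫ x, x ∂FC from rfl]
  have := isProbabilityMeasure_stationaryExcess hB0 hB hBpos
  have := isProbabilityMeasure_stationaryExcess hC0 hC hCpos
  rw [correctedReplace, h₁.ruinProb_eq_one hr (integrable_mixtureLaw hB hC) hlt,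
    h₀.ruinProb_eq_one hr hB hload, h₀.tailTwoMaxAdd_eq_one hr hB hload,
    h₀.tailTwoMaxAdd_eq_one hr hB hload]
  ring

end CorrectedReplace

theorem theoremt
    (rate : ℝ) (hrate : 0 < rate)
    (FB FC : Measure ℝ) [IsProbabilityMeasure FB] [IsProbabilityMeasure FC]
    (hB_nonneg : ∀ᵐ x ∂FB, 0 ≤ x) (hC_nonneg : ∀ᵐ x ∂FC, 0 ≤ x)
    (hB_int : Integrable (fun x : ℝ => x) FB) (hC_int : Integrable (fun x : ℝ => x) FC)
    (hB_pos : 0 < ∫ x, x ∂FB) (hC_pos : 0 < ∫ x, x ∂FC)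
    {Ω : Type*} [MeasurableSpace Ω] (P : ℝ → Measure Ω) (T U : ℝ → ℕ → Ω → ℝ)
    (hmodel : ∀ ε ∈ Set.Icc (0 : ℝ) 1,
      IsCramerLundberg (P ε) (T ε) (U ε) rate (mixtureLaw ε FB FC))
    (δ θ : ℝ) (hδ : δ = load rate FB) (hθ : θ = load rate FC) :
    (∀ ε ∈ Set.Icc (0 : ℝ) 1, ε < |1 - δ| / (δ + θ) → ∀ u : ℝ, 0 ≤ u →
      |ruinProb (P ε) (T ε) (U ε) u - correctedReplace (P 0) (T 0) (U 0) rate FB FC ε u|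
        ≤ (ε / (1 - δ)) ^ 2 * (δ + θ) ^ 2 * ((1 - δ) / (1 - δ - ε * (δ + θ)))) ∧
    (δ ≠ 1 → ∃ K : ℝ, ∀ᶠ ε in 𝓝[Set.Icc (0 : ℝ) 1] 0, ∀ u : ℝ, 0 ≤ u →
      |ruinProb (P ε) (T ε) (U ε) u - correctedReplace (P 0) (T 0) (U 0) rate FB FC ε u|
        ≤ K * ε ^ 2) := by
  have hδ0 : 0 < δ := hδ ▸ mul_pos hrate hB_pos
  have hθ0 : 0 < θ := hθ ▸ mul_pos hrate hC_pos
  have hsum : 0 < δ + θ := add_pos hδ0 hθ0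
  have hbase : IsCramerLundberg (P 0) (T 0) (U 0) rate FB := by
    have := hmodel 0 (by simp)
    rwa [mixtureLaw_zero] at this
  have hbound : ∀ ε ∈ Set.Icc (0 : ℝ) 1, ε < |1 - δ| / (δ + θ) → ∀ u : ℝ, 0 ≤ u →
      |ruinProb (P ε) (T ε) (U ε) u - correctedReplace (P 0) (T 0) (U 0) rate FB FC ε u|
        ≤ (ε / (1 - δ)) ^ 2 * (δ + θ) ^ 2 * ((1 - δ) / (1 - δ - ε * (δ + θ))) := by
    intro ε hε hlt u _
    rw [lt_div_iff₀ hsum] at hlt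
    have hnn : 0 ≤ ε * (δ + θ) := mul_nonneg hε.1 hsum.le
    rcases lt_or_ge δ 1 with h | h
    · rw [abs_of_pos (sub_pos.2 h)] at hlt
      subst hδ hθ
      exact abs_ruinProb_sub_correctedReplace_le_of_load_lt_one hrate hB_nonneg hC_nonneg
        hB_int hC_int hB_pos hC_pos hbase (hmodel ε hε) hε h hlt u
    -- Here `hlt` forces `1 < δ`: for `δ = 1` no `ε` is admissible.
    · rw [abs_of_nonpos (by linarith)] at hlt
      have hdiv : 0 ≤ (1 - δ) / (1 - δ - ε * (δ + θ)) :=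
        div_nonneg_of_nonpos (by linarith) (by linarith)
      rw [ruinProb_sub_correctedReplace_of_one_lt_load hrate hB_nonneg hC_nonneg
        hB_int hC_int hB_pos hC_pos hbase (hmodel ε hε) hε (hδ ▸ by linarith)
        (by rw [← hδ, ← hθ]; linarith) u, abs_zero]
      positivity
  refine ⟨hbound, fun hδ1 => ⟨(1 / (1 - δ)) ^ 2 * (δ + θ) ^ 2 * 2, ?_⟩⟩
  have hgap : 0 < |1 - δ| := abs_pos.2 (sub_ne_zero.2 hδ1.symm)
  -- For `ε` up to half of the admissible range, the last factor of the bound is at most `2`.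
  have hev : ∀ᶠ ε in 𝓝[Set.Icc (0 : ℝ) 1] 0, ε < |1 - δ| / (2 * (δ + θ)) :=
    (eventually_lt_nhds (by positivity)).filter_mono nhdsWithin_le_nhds
  filter_upwards [hev, self_mem_nhdsWithin] with ε hlt hε u hu
  rw [lt_div_iff₀ (by positivity)] at hlt
  have hnn : 0 ≤ ε * (δ + θ) := mul_nonneg hε.1 hsum.le
  refine (hbound ε hε (by rw [lt_div_iff₀ hsum]; linarith) u hu).trans ?_
  have hfactor : (1 - δ) / (1 - δ - ε * (δ + θ)) ≤ 2 := by
    rcases lt_or_gt_of_ne hδ1 with h | h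
    · rw [abs_of_pos (sub_pos.2 h)] at hlt
      rw [div_le_iff₀ (by linarith)]
      linarith
    · rw [div_le_iff_of_neg (by linarith)]
      linarith
  refine (mul_le_mul_of_nonneg_left hfactor (by positivity)).trans (le_of_eq ?_)
  ring
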